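/- All topological spaces are assumed Tychonoff. Let $S$ be a topological semigroup (a semigroup with a topology for which multiplication $S\times S\to S$ is jointly continuous) that contains a dense subgroup, that is, a dense subset which is closed under multiplication and is a group under the restricted operation, and suppose that the square $S\times S$ is countably compact (every countable open cover has a finite subcover). For a class $\mathcal C$ of compact Hausdorff semitopological semigroups (semigroups with separately continuous multiplication), a $\mathcal C$-compactification of $S$ is a member $\mathcal C(S)$ of $\mathcal C$ together with a continuous homomorphism $\eta:S\to\mathcal C(S)$ such that for every continuous homomorphism $h:S\to K$ with $K\in\mathcal C$ there is a unique continuous homomorphism $\bar h:\mathcal C(S)\to K$ with $h=\bar h\circ\eta$. Let $\mathrm{WAP}(S)$, $\mathrm{AP}(S)$ and $\mathrm{SAP}(S)$ denote the $\mathcal C$-compactifications of $S$ for the classes of compact Hausdorff semitopological semigroups, compact Hausdorff topological semigroups, and compact Hausdorff topological groups, respectively. Let $\beta S$ be the Stone–Čech compactification of $S$. Then the canonical maps $$\beta S\to\mathrm{WAP}(S)\to\mathrm{AP}(S)\to\mathrm{SAP}(S)$$ are homeomorphisms. Here the first map is the unique continuous extension to $\beta S$ of $\eta:S\to\mathrm{WAP}(S)$,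 and the other two are the unique continuous homomorphisms compatible with the canonical homomorphisms from $S$. -/

import Mathlib

universe u

/-- A subset `H` of a semigroup is a subgroup if it is closed under multiplication and is a group
under the restricted operation (its identity is an idempotent of the semigroup). -/
def IsSubgroupOfSemigroup {S : Type u} [Semigroup S] (H : Set S) : Prop :=
  (∀ x ∈ H, ∀ y ∈ H, x * y ∈ H) ∧
    ∃ e ∈ H, ∀ x ∈ H, e * x = x ∧ x * e = x ∧ ∃ y ∈ H, x * y = e ∧ y * x = e

/-- A property of semigroups with a topology. Together with compactness, the Hausdorff property
and separate continuity of the operation (see `IsCompactification`), it describes a class of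
compact Hausdorff semitopological semigroups. -/
abbrev SemigroupClass : Type (u + 1) :=
  ∀ (K : Type u) [Semigroup K] [TopologicalSpace K], Prop

/-- All compact semitopological semigroups. -/
def WAPClass : SemigroupClass.{u} := fun _ _ _ => True

/-- Compact topological semigroups. -/
def APClass : SemigroupClass.{u} := fun K _ _ => ContinuousMul K

/-- Compact topological groups: the semigroup operation is that of a topological group. -/
def SAPClass : SemigroupClass.{u} := fun K inst _ =>
  ∃ G : Group K, G.toDivInvMonoid.toMonoid.toSemigroup = inst ∧ IsTopologicalGroup K

/-- Inclusion of classes of semigroups. -/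
def SemigroupClass.Le (D C : SemigroupClass.{u}) : Prop :=
  ∀ (K : Type u) [Semigroup K] [TopologicalSpace K], D K → C K

theorem APClass_le_WAPClass : SemigroupClass.Le APClass.{u} WAPClass.{u} :=
  fun _ _ _ _ => trivial

theorem SAPClass_le_APClass : SemigroupClass.Le SAPClass.{u} APClass.{u} := by
  rintro K inst _ ⟨G, rfl, h⟩
  exact h.toContinuousMul

/-- `(W, η)` is a `C`-compactification of the semitopological semigroup `S`: `W` is a compact
Hausdorff semitopological semigroup in the class `C`, `η : S → W` is a continuous homomorphism,
and every continuous homomorphism from `S` to a member of the class factors through `η` by a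
unique continuous homomorphism. -/
structure IsCompactification (C : SemigroupClass.{u}) {S : Type u} [Semigroup S]
    [TopologicalSpace S] {W : Type u} [Semigroup W] [TopologicalSpace W] (η : S →ₙ* W) : Prop where
  compactSpace : CompactSpace W
  t2Space : T2Space W
  separatelyContinuousMul : SeparatelyContinuousMul W
  mem : C W
  continuous : Continuous η
  existsUnique_lift : ∀ (K : Type u) [Semigroup K] [TopologicalSpace K] [CompactSpace K]
    [T2Space K] [SeparatelyContinuousMul K], C K → ∀ h : S →ₙ* K, Continuous h →
      ∃! g : W →ₙ* K, Continuous g ∧ g.comp η = h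

namespace IsCompactification

variable {C D : SemigroupClass.{u}} {S : Type u} [Semigroup S] [TopologicalSpace S]
  {W : Type u} [Semigroup W] [TopologicalSpace W] {A : Type u} [Semigroup A] [TopologicalSpace A]
  {η : S →ₙ* W} {θ : S →ₙ* A}

/-- The continuous extension `βη : βS → W` of `η : S → W`. -/
noncomputable def betaMap (hη : IsCompactification C η) : StoneCech S → W :=
  haveI := hη.compactSpace
  haveI := hη.t2Space
  stoneCechExtend hη.continuous

theorem existsUnique_map (hη : IsCompactification C η) (hθ : IsCompactification D θ)
    (hDC : D.Le C) : ∃! g : W →ₙ* A, Continuous g ∧ g.comp η = θ :=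
  haveI := hθ.compactSpace
  haveI := hθ.t2Space
  haveI := hθ.separatelyContinuousMul
  hη.existsUnique_lift A (hDC A hθ.mem) θ hθ.continuous

/-- For classes `D ⊆ C`, the canonical homomorphism from the `C`-compactification to the
`D`-compactification: the unique continuous homomorphism compatible with the maps from `S`. -/
noncomputable def map (hη : IsCompactification C η) (hθ : IsCompactification D θ)
    (hDC : D.Le C) : W →ₙ* A :=
  (hη.existsUnique_map hθ hDC).choose

theorem continuous_map (hη : IsCompactification C η) (hθ : IsCompactification D θ)
    (hDC : D.Le C) : Continuous (hη.map hθ hDC) :=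
  (hη.existsUnique_map hθ hDC).choose_spec.1.1

theorem map_comp (hη : IsCompactification C η) (hθ : IsCompactification D θ)
    (hDC : D.Le C) : (hη.map hθ hDC).comp η = θ :=
  (hη.existsUnique_map hθ hDC).choose_spec.1.2

end IsCompactification

/-! Existence of the three compactifications, as Hausdorff quotients of the Stone-Cech
compactification. -/

namespace SemigroupCompactification

/-- A continuous homomorphism from `S` to a member of the class `C`. -/
structure Rep (C : SemigroupClass.{u}) (S : Type u) [Semigroup S] [TopologicalSpace S] where
  K : Type u
  [sg : Semigroup K]
  [top : TopologicalSpace K]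
  [cpt : CompactSpace K]
  [t2 : T2Space K]
  [sc : SeparatelyContinuousMul K]
  mem : C K
  h : S →ₙ* K
  cont : Continuous h

attribute [instance] Rep.sg Rep.top Rep.cpt Rep.t2 Rep.sc

variable (C : SemigroupClass.{u}) (S : Type u) [Semigroup S] [TopologicalSpace S]

noncomputable def ext (x : StoneCech S) : ∀ r : Rep C S, r.K := fun r => stoneCechExtend r.cont x

theorem continuous_ext : Continuous (ext C S) :=
  continuous_pi fun r => continuous_stoneCechExtend r.cont

theorem ext_unit (s : S) (r : Rep C S) : ext C S (stoneCechUnit s) r = r.h s :=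
  stoneCechExtend_stoneCechUnit r.cont s

def Q : Type u := Quotient (Setoid.ker (ext C S))

instance : TopologicalSpace (Q C S) := inferInstanceAs (TopologicalSpace (Quotient _))
instance : CompactSpace (Q C S) := inferInstanceAs (CompactSpace (Quotient _))

noncomputable def ev : Q C S → ∀ r : Rep C S, r.K :=
  Quotient.lift (ext C S) fun _ _ h => h

noncomputable def mk (x : StoneCech S) : Q C S := Quotient.mk _ x

theorem continuous_mk : Continuous (mk C S) := continuous_quotient_mk'

theorem mk_surjective : Function.Surjective (mk C S) := Quotient.mk_surjective

theorem ev_injective : Function.Injective (ev C S) := by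
  rintro ⟨x⟩ ⟨y⟩ h
  exact Quotient.sound h

theorem continuous_ev : Continuous (ev C S) := (continuous_ext C S).quotient_lift _

instance : T2Space (Q C S) := T2Space.of_injective_continuous (ev_injective C S) (continuous_ev C S)

theorem isClosedEmbedding_ev : Topology.IsClosedEmbedding (ev C S) :=
  (continuous_ev C S).isClosedEmbedding (ev_injective C S)

variable [SeparatelyContinuousMul S]

theorem exists_ext_mul (x y : StoneCech S) : ∃ z, ext C S z = ext C S x * ext C S y := by
  have hL : ∀ s : S, Continuous fun t : S => stoneCechUnit (s * t) := fun s =>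
    continuous_stoneCechUnit.comp (continuous_const_mul s)
  let L : S → StoneCech S := fun s => stoneCechExtend (hL s) y
  have hLy : ∀ s, ext C S (L s) = ext C S (stoneCechUnit s) * ext C S y := by
    intro s
    funext r
    have : ((fun z => ext C S z r) ∘ stoneCechExtend (hL s)) = fun y => r.h s * ext C S y r := by
      refine stoneCech_hom_ext ((continuous_stoneCechExtend r.cont).comp
        (continuous_stoneCechExtend (hL s)))
        ((continuous_const_mul _).comp (continuous_stoneCechExtend r.cont)) ?_
      funext t
      simp [ext, stoneCechExtend_stoneCechUnit]
    have h2 := congrFun this y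
    simp only [Function.comp] at h2
    rw [Pi.mul_apply, ext_unit]
    exact h2
  have hx : x ∈ closure (Set.range (stoneCechUnit : S → StoneCech S)) :=
    denseRange_stoneCechUnit x
  have hne : (Filter.comap (stoneCechUnit : S → StoneCech S) (nhds x)).NeBot :=
    Filter.comap_neBot_iff.2 fun t ht => by
      obtain ⟨_, hy, s, rfl⟩ := mem_closure_iff_nhds.1 hx t ht
      exact ⟨s, hy⟩
  let U : Ultrafilter S := Ultrafilter.of (Filter.comap stoneCechUnit (nhds x))
  have hU : Filter.Tendsto (stoneCechUnit : S → StoneCech S) U (nhds x) :=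
    Filter.tendsto_iff_comap.2 (Ultrafilter.of_le _)
  obtain ⟨z, -, hz⟩ := isCompact_univ.ultrafilter_le_nhds (U.map L) (by simp)
  have hz : Filter.Tendsto L U (nhds z) := hz
  refine ⟨z, ?_⟩
  funext r
  have h1 : Filter.Tendsto (fun s => ext C S (L s) r) U (nhds (ext C S z r)) :=
    ((continuous_stoneCechExtend r.cont).tendsto z).comp hz
  have h2 : Filter.Tendsto (fun s => ext C S (L s) r) U (nhds (ext C S x r * ext C S y r)) := by
    simp only [hLy, Pi.mul_apply]
    exact ((continuous_mul_const (ext C S y r)).tendsto _).comp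
      (((continuous_stoneCechExtend r.cont).tendsto x).comp hU)
  exact tendsto_nhds_unique h1 h2

theorem exists_ev_mul (p q : Q C S) : ∃ z, ev C S z = ev C S p * ev C S q := by
  obtain ⟨x, rfl⟩ := mk_surjective C S p
  obtain ⟨y, rfl⟩ := mk_surjective C S q
  obtain ⟨z, hz⟩ := exists_ext_mul C S x y
  exact ⟨mk C S z, hz⟩

noncomputable instance : Mul (Q C S) := ⟨fun p q => (exists_ev_mul C S p q).choose⟩

theorem ev_mul (p q : Q C S) : ev C S (p * q) = ev C S p * ev C S q :=
  (exists_ev_mul C S p q).choose_spec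

noncomputable instance : Semigroup (Q C S) := (ev_injective C S).semigroup _ (ev_mul C S)

instance : SeparatelyContinuousMul (Q C S) where
  continuous_const_mul {a} := by
    rw [(isClosedEmbedding_ev C S).continuous_iff, continuous_pi_iff]
    intro r
    simp only [Function.comp_def, ev_mul, Pi.mul_apply]
    exact (continuous_const_mul _).comp ((continuous_apply r).comp (continuous_ev C S))
  continuous_mul_const {a} := by
    rw [(isClosedEmbedding_ev C S).continuous_iff, continuous_pi_iff]
    intro r
    simp only [Function.comp_def, ev_mul, Pi.mul_apply]
    exact (continuous_mul_const _).comp ((continuous_apply r).comp (continuous_ev C S))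

noncomputable def unit : S →ₙ* Q C S where
  toFun s := mk C S (stoneCechUnit s)
  map_mul' s t := by
    apply ev_injective
    rw [ev_mul]
    funext r
    change ext C S _ r = ext C S _ r * ext C S _ r
    simp only [ext_unit, map_mul]

theorem continuous_unit : Continuous (unit C S) :=
  (continuous_mk C S).comp continuous_stoneCechUnit

theorem denseRange_unit : DenseRange (unit C S) :=
  (mk_surjective C S).denseRange.comp denseRange_stoneCechUnit (continuous_mk C S)

theorem isCompactification_unit (hC : C (Q C S)) : IsCompactification C (unit C S) where
  compactSpace := inferInstance
  t2Space := inferInstance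
  separatelyContinuousMul := inferInstance
  mem := hC
  continuous := continuous_unit C S
  existsUnique_lift := by
    intro K _ _ _ _ _ hK h hh
    let r : Rep C S := ⟨K, hK, h, hh⟩
    have hc : Continuous fun p => ev C S p r := (continuous_apply r).comp (continuous_ev C S)
    refine ⟨⟨fun p => ev C S p r, fun p q => by rw [ev_mul]; rfl⟩, ⟨hc, ?_⟩, ?_⟩
    · ext s
      exact ext_unit C S s r
    · rintro g ⟨hg, hgh⟩
      refine DFunLike.coe_injective ((denseRange_unit C S).equalizer hg hc ?_)
      funext s
      exact (DFunLike.congr_fun hgh s).trans (ext_unit C S s r).symm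

theorem continuousMul (hC : C.Le APClass) : ContinuousMul (Q C S) where
  continuous_mul := by
    rw [(isClosedEmbedding_ev C S).continuous_iff, continuous_pi_iff]
    intro r
    have : ContinuousMul r.K := hC _ r.mem
    have h : Continuous fun p => ev C S p r := (continuous_apply r).comp (continuous_ev C S)
    simp only [Function.comp_def, ev_mul, Pi.mul_apply]
    exact (h.comp continuous_fst).mul (h.comp continuous_snd)

theorem idem_of_SAPClass {K : Type u} [inst : Semigroup K] [TopologicalSpace K] (hK : SAPClass K)
    {a : K} (ha : a * a = a) (b : K) : a * b = b ∧ b * a = b := by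
  obtain ⟨G, rfl, -⟩ := hK
  have : a = 1 := mul_eq_left.1 ha
  subst this
  exact ⟨one_mul b, mul_one b⟩

/-- An idempotent of the quotient is a two-sided identity if all targets are groups. -/
theorem idem {e : Q SAPClass S} (he : e * e = e) (x : Q SAPClass S) : e * x = x ∧ x * e = x := by
  have key : ∀ r : Rep SAPClass S, ev _ S e r * ev _ S x r = ev _ S x r ∧
      ev _ S x r * ev _ S e r = ev _ S x r := fun r =>
    idem_of_SAPClass r.mem (by rw [← Pi.mul_apply, ← ev_mul, he]) _
  exact ⟨ev_injective _ S (by rw [ev_mul]; exact funext fun r => (key r).1),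
    ev_injective _ S (by rw [ev_mul]; exact funext fun r => (key r).2)⟩

theorem exists_right_inv [Nonempty (Q SAPClass S)] (x : Q SAPClass S) :
    ∃ y, (x * y) * (x * y) = x * y := by
  have := continuousMul SAPClass S SAPClass_le_APClass
  have h := exists_idempotent_in_compact_subsemigroup
    (fun r : Q SAPClass S => continuous_mul_const r) (Set.range fun y => x * y)
    (Set.range_nonempty _) (isCompact_range (continuous_const_mul x)) (by
      rintro _ ⟨y, rfl⟩ _ ⟨z, rfl⟩
      exact ⟨y * (x * z), by simp only [mul_assoc]⟩)
  obtain ⟨_, ⟨y, rfl⟩, hy⟩ := h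
  exact ⟨y, hy⟩

theorem SAPClass_Q [Nonempty S] : SAPClass (Q SAPClass S) := by
  obtain ⟨s⟩ := ‹Nonempty S›
  have hne : Nonempty (Q SAPClass S) := ⟨unit SAPClass S s⟩
  have hmul := continuousMul SAPClass S SAPClass_le_APClass
  choose inv hinv using exists_right_inv S
  let e : Q SAPClass S := unit SAPClass S s * inv (unit SAPClass S s)
  have he : e * e = e := hinv _
  letI : One (Q SAPClass S) := ⟨e⟩
  letI : Inv (Q SAPClass S) := ⟨inv⟩
  have hri : ∀ a : Q SAPClass S, a * a⁻¹ = 1 := fun a =>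
    (idem S he _).2.symm.trans (idem S (hinv a) e).1
  have hli : ∀ a : Q SAPClass S, a⁻¹ * a = 1 := fun a => by
    have h2 : a⁻¹ * a * (a⁻¹ * a) = a⁻¹ * a := by
      rw [mul_assoc, ← mul_assoc a, hri a, show (1 : Q SAPClass S) * a = a from (idem S he a).1]
    exact (idem S he _).2.symm.trans (idem S h2 e).1
  let G : Group (Q SAPClass S) :=
    { (inferInstance : Semigroup (Q SAPClass S)) with
      one := e
      inv := inv
      one_mul := fun a => (idem S he a).1
      mul_one := fun a => (idem S he a).2
      inv_mul_cancel := hli }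
  refine ⟨G, rfl, ?_⟩
  have hcinv : Continuous inv := by
    rw [continuous_iff_isClosed]
    intro A hA
    have hcl : IsClosed {p : Q SAPClass S × Q SAPClass S | p.1 * p.2 = e ∧ p.2 ∈ A} :=
      (isClosed_eq continuous_mul continuous_const).inter (hA.preimage continuous_snd)
    convert isClosedMap_fst_of_compactSpace _ hcl using 1
    ext x
    constructor
    · intro hx
      exact ⟨(x, inv x), ⟨hri x, hx⟩, rfl⟩
    · rintro ⟨⟨a, b⟩, ⟨h1, h2⟩, rfl⟩
      have h3 : b = inv a := by
        calc b = e * b := (idem S he b).1.symm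
          _ = inv a * a * b := by rw [show inv a * a = e from hli a]
          _ = inv a := by rw [mul_assoc, h1]; exact (idem S he _).2
      change inv a ∈ A
      rw [← h3]
      exact h2
  exact { continuous_mul := hmul.continuous_mul, continuous_inv := hcinv }

end SemigroupCompactification

open SemigroupCompactification in
theorem exists_WAP_compactification (S : Type u) [Semigroup S] [TopologicalSpace S]
    [SeparatelyContinuousMul S] :
    ∃ (W : Type u) (_ : Semigroup W) (_ : TopologicalSpace W) (η : S →ₙ* W),
      IsCompactification WAPClass η :=
  ⟨_, _, _, _, isCompactification_unit WAPClass S trivial⟩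

open SemigroupCompactification in
theorem exists_AP_compactification (S : Type u) [Semigroup S] [TopologicalSpace S]
    [SeparatelyContinuousMul S] :
    ∃ (A : Type u) (_ : Semigroup A) (_ : TopologicalSpace A) (η : S →ₙ* A),
      IsCompactification APClass η :=
  ⟨_, _, _, _, isCompactification_unit APClass S (continuousMul APClass S fun _ _ _ h => h)⟩

open SemigroupCompactification in
theorem exists_SAP_compactification (S : Type u) [Semigroup S] [TopologicalSpace S]
    [SeparatelyContinuousMul S] [Nonempty S] :
    ∃ (G : Type u) (_ : Semigroup G) (_ : TopologicalSpace G) (η : S →ₙ* G),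
      IsCompactification SAPClass η :=
  ⟨_, _, _, _, isCompactification_unit SAPClass S (SAPClass_Q S)⟩

/-! Countable compactness of `S × S` makes multiplication extend to a jointly continuous map `βS ×
βS → βS` (Glicksberg, `exists_continuous_extend_stoneCech_prod`), which is associative by density.
The image of the dense subgroup is dense in `βS`, and a compact topological semigroup with a dense
subgroup is a topological group (`SAPClass_of_dense_subgroup`). So `βS` lies in all three classes.
Since it already has the universal property for continuous maps to compact Hausdorff spaces, it is
each of the three compactifications (`isHomeomorph_betaMap`), and the connecting maps are
homeomorphisms by cancellation. -/

open Filter Topology Uniformity SetRel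

/-! ### Glicksberg's extension theorem -/

/-- A sequence in a countably compact space visits every neighbourhood of some point along two
indices `m < n`. -/
theorem CountablyCompactSpace.exists_forall_nhds_exists_lt {X : Type*} [TopologicalSpace X]
    [CountablyCompactSpace X] (u : ℕ → X) :
    ∃ a, ∀ U ∈ 𝓝 a, ∃ m n, m < n ∧ u m ∈ U ∧ u n ∈ U := by
  obtain ⟨a, -, ha⟩ := isCountablyCompact_iff_seq_clusterPt.1
    (CountablyCompactSpace.isCountablyCompact_univ (E := X)) u (by simp)
  refine ⟨a, fun U hU => ?_⟩
  have hf := frequently_atTop.1 (mapClusterPt_iff_frequently.1 ha U hU)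
  obtain ⟨m, -, hm⟩ := hf 0
  obtain ⟨n, hn, hn'⟩ := hf (m + 1)
  exact ⟨m, n, hn, hm, hn'⟩

/-- A continuous function into a uniform space on a countably compact product is continuous in the
first variable, uniformly in the second one. -/
theorem Continuous.eventually_forall_mem_of_countablyCompactSpace_prod {X Y K : Type*}
    [TopologicalSpace X] [TopologicalSpace Y] [CountablyCompactSpace (X × Y)] [UniformSpace K]
    {f : X × Y → K} (hf : Continuous f) (x₀ : X) {V : Set (K × K)} (hV : V ∈ 𝓤 K) :
    ∀ᶠ x in 𝓝 x₀, ∀ y, (f (x₀, y), f (x, y)) ∈ V := by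
  obtain ⟨W, hW, hsymm, hWV⟩ := comp_comp_symm_mem_uniformity_sets hV
  by_contra hcon
  -- Choose `(xₙ, yₙ)` so that `yₙ` witnesses failure at `xₙ`, with `xₙ` so near `x₀` that `f (xₙ,
  -- yₘ)` is `W`-close to `f (x₀, yₘ)` for all earlier `m`.
  obtain ⟨u, hu, hlt⟩ := exists_seq_of_forall_finset_exists
    (fun p : X × Y => (f (x₀, p.2), f p) ∉ V)
    (fun p q : X × Y => (f (x₀, p.2), f (q.1, p.2)) ∈ W) (by
      intro s _
      have h1 : ∀ᶠ x in 𝓝 x₀, ∀ p ∈ s, (f (x₀, p.2), f (x, p.2)) ∈ W := by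
        rw [Filter.eventually_all_finset]
        intro p _
        have hc : Continuous fun x => f (x, p.2) := by fun_prop
        exact hc.continuousAt.eventually (UniformSpace.ball_mem_nhds _ hW)
      obtain ⟨x, hx, hxs⟩ := ((not_eventually.1 hcon).and_eventually h1).exists
      obtain ⟨y, hy⟩ := not_forall.1 hx
      exact ⟨(x, y), hy, hxs⟩)
  obtain ⟨⟨a, b⟩, hab⟩ := CountablyCompactSpace.exists_forall_nhds_exists_lt u
  have hnhds := hf.continuousAt.eventually (UniformSpace.ball_mem_nhds (f (a, b)) hW)
  rw [nhds_prod_eq] at hnhds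
  -- A box neighbourhood is needed because it also contains the mixed point `(xₙ, yₘ)`. This gives
  -- the chain `f (x₀, yₘ)`, `f (xₙ, yₘ)`, `f (a, b)`, `f (xₘ, yₘ)` with three `W`-steps.
  obtain ⟨P, hP, Q, hQ, hPQ⟩ := Filter.mem_prod_iff.1 hnhds
  obtain ⟨m, n, hmn, hm, hn⟩ := hab (P ×ˢ Q) (prod_mem_nhds hP hQ)
  refine hu m (hWV ⟨f (a, b), ⟨f ((u n).1, (u m).2), hlt m n hmn, ?_⟩, ?_⟩)
  · exact hsymm.symm _ _ (hPQ (Set.mk_mem_prod hn.1 hm.2))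
  · exact hPQ (Set.mk_mem_prod hm.1 hm.2)

/-- Otherwise some sequence has values that are pairwise `V`-far apart, yet two of its terms must
come close to the value at a cluster point. -/
theorem Continuous.totallyBounded_range_of_countablyCompactSpace {X K : Type*} [TopologicalSpace X]
    [CountablyCompactSpace X] [UniformSpace K] {F : X → K} (hF : Continuous F) :
    TotallyBounded (Set.range F) := by
  intro V hV
  obtain ⟨W, hW, hsymm, hWV⟩ := comp_symm_mem_uniformity_sets hV
  by_contra hcon
  obtain ⟨u, -, hlt⟩ := exists_seq_of_forall_finset_exists (fun _ : X => True)
    (fun x y : X => (F y, F x) ∉ V) (by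
      intro s _
      by_contra! hs
      refine hcon ⟨F '' s, s.finite_toSet.image F, ?_⟩
      rintro _ ⟨y, rfl⟩
      obtain ⟨x, hx, hxy⟩ := hs y trivial
      exact Set.mem_biUnion (Set.mem_image_of_mem F hx) hxy)
  obtain ⟨a, ha⟩ := CountablyCompactSpace.exists_forall_nhds_exists_lt u
  obtain ⟨m, n, hmn, hm, hn⟩ := ha _ (hF.continuousAt.preimage_mem_nhds
    (UniformSpace.ball_mem_nhds (F a) hW))
  exact hlt m n hmn (hWV ⟨F a, hsymm.symm _ _ hn, hm⟩)

/-- A form of Glicksberg's theorem: a continuous function from a countably compact product to a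
compact Hausdorff space extends continuously to the product of the Stone-Čech compactifications. -/
theorem exists_continuous_extend_stoneCech_prod {X Y K : Type*} [TopologicalSpace X]
    [TopologicalSpace Y] [CountablyCompactSpace X] [CountablyCompactSpace (X × Y)]
    [TopologicalSpace K] [CompactSpace K] [T2Space K] {f : X × Y → K} (hf : Continuous f) :
    ∃ g : StoneCech X × StoneCech Y → K, Continuous g ∧
      ∀ x y, g (stoneCechUnit x, stoneCechUnit y) = f (x, y) := by
  let _ : UniformSpace K := uniformSpaceOfCompactR1
  have hfx : ∀ x, Continuous fun y => f (x, y) := fun x => by fun_prop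
  -- Curry `f` and extend in the second variable; it remains to extend `F` itself over `βX`.
  let F : X → C(StoneCech Y, K) := fun x => ⟨_, continuous_stoneCechExtend (hfx x)⟩
  have hFu : ∀ x y, F x (stoneCechUnit y) = f (x, y) := fun x y =>
    stoneCechExtend_stoneCechUnit (hfx x) y
  have hF : Continuous F := by
    refine continuous_iff_continuousAt.2 fun x₀ => ?_
    refine ContinuousMap.tendsto_iff_tendstoUniformly.2 fun V hV => ?_
    -- A closed entourage lets the uniform estimate pass from `Y` to `βY` by density.
    obtain ⟨W, hW, hWc, hWV⟩ := mem_uniformity_isClosed hV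
    filter_upwards [hf.eventually_forall_mem_of_countablyCompactSpace_prod x₀ hW] with x hx z
    refine hWV (denseRange_stoneCechUnit.induction_on z
      (hWc.preimage ((F x₀).continuous.prodMk (F x).continuous)) fun y => ?_)
    simpa only [hFu] using hx y
  -- Extending over `βX` requires a compact target. The closure of the range is one, being totally
  -- bounded and closed in a complete function space.
  let T : Set C(StoneCech Y, K) := closure (Set.range F)
  have hFT : ∀ x, F x ∈ T := fun x => subset_closure (Set.mem_range_self x)
  have hT : IsCompact T := isCompact_iff_totallyBounded_isComplete.2 ⟨
    hF.totallyBounded_range_of_countablyCompactSpace.closure, isClosed_closure.isComplete⟩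
  have : CompactSpace T := isCompact_iff_compactSpace.1 hT
  have hFT' : Continuous fun x => (⟨F x, hFT x⟩ : T) :=
    hF.subtype_mk _
  refine ⟨fun p => (stoneCechExtend hFT' p.1).1 p.2, ?_, fun x y => ?_⟩
  · exact ((continuous_subtype_val.comp (continuous_stoneCechExtend hFT')).comp
      continuous_fst).eval continuous_snd
  · dsimp only
    rw [stoneCechExtend_stoneCechUnit]
    exact hFu x y

/-! ### Dense subgroups of compact semigroups -/

/-- A compact Hausdorff topological semigroup with a dense subgroup is a topological group. -/
theorem SAPClass_of_dense_subgroup {K : Type u} [Semigroup K] [TopologicalSpace K] [CompactSpace K]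
    [T2Space K] [ContinuousMul K] {H : Set K} (hH : IsSubgroupOfSemigroup H) (hd : Dense H) :
    SAPClass K := by
  obtain ⟨-, e, -, he⟩ := hH
  have hone : ∀ x, e * x = x ∧ x * e = x := fun x =>
    hd.induction (P := fun x => e * x = x ∧ x * e = x) (fun y hy => ⟨(he y hy).1, (he y hy).2.1⟩)
      ((isClosed_eq (by fun_prop) (by fun_prop)).and (isClosed_eq (by fun_prop) (by fun_prop))) x
  have hR : IsClosed {p : K × K | p.1 * p.2 = e ∧ p.2 * p.1 = e} :=
    (isClosed_eq (by fun_prop) (by fun_prop)).inter (isClosed_eq (by fun_prop) (by fun_prop))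
  have hinv : ∀ x : K, ∃ y, x * y = e ∧ y * x = e := by
    intro x
    -- Projection along a compact factor is closed, so the set of invertible elements is closed; it
    -- contains the dense set `H`.
    have hcl := isClosedMap_fst_of_compactSpace _ hR
    have hsub : H ⊆ Prod.fst '' {p : K × K | p.1 * p.2 = e ∧ p.2 * p.1 = e} := fun x hx => by
      obtain ⟨y, -, hy⟩ := (he x hx).2.2
      exact ⟨(x, y), hy, rfl⟩
    obtain ⟨⟨a, b⟩, hab, rfl⟩ := hcl.closure_subset_iff.2 hsub (hd x)
    exact ⟨b, hab⟩
  choose inv hinv using hinv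
  have huniq : ∀ x y : K, x * y = e → y = inv x := fun x y h => by
    rw [← (hone y).1, ← (hinv x).2, mul_assoc, h, (hone _).2]
  let G : Group K :=
    { (inferInstance : Semigroup K) with
      one := e
      inv := inv
      one_mul := fun a => (hone a).1
      mul_one := fun a => (hone a).2
      inv_mul_cancel := fun a => (hinv a).2 }
  have hcinv : Continuous inv := by
    refine continuous_iff_isClosed.2 fun A hA => ?_
    -- By uniqueness of inverses, `inv ⁻¹' A` is the projection of the part of the closed inverse
    -- relation lying over `A`.
    convert isClosedMap_fst_of_compactSpace _ (hR.inter (hA.preimage continuous_snd)) using 1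
    ext x
    constructor
    · intro hx
      exact ⟨(x, inv x), ⟨hinv x, hx⟩, rfl⟩
    · rintro ⟨⟨a, b⟩, ⟨hab, hb⟩, rfl⟩
      change inv a ∈ A
      rw [← huniq a b hab.1]
      exact hb
  exact ⟨G, rfl, { continuous_mul := continuous_mul, continuous_inv := hcinv }⟩

theorem IsSubgroupOfSemigroup.image {S T : Type u} [Semigroup S] [Semigroup T] {H : Set S}
    (hH : IsSubgroupOfSemigroup H) (φ : S →ₙ* T) : IsSubgroupOfSemigroup (φ '' H) := by
  obtain ⟨hmul, e, heH, he⟩ := hH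
  refine ⟨?_, φ e, ⟨e, heH, rfl⟩, ?_⟩
  · rintro _ ⟨x, hx, rfl⟩ _ ⟨y, hy, rfl⟩
    exact ⟨x * y, hmul x hx y hy, map_mul φ x y⟩
  · rintro _ ⟨x, hx, rfl⟩
    obtain ⟨h1, h2, y, hy, h3, h4⟩ := he x hx
    exact ⟨by rw [← map_mul, h1], by rw [← map_mul, h2], φ y, ⟨y, hy, rfl⟩,
      by rw [← map_mul, h3], by rw [← map_mul, h4]⟩

/-! ### The semigroup `βS` and its universal properties -/

/-- If `S × S` is countably compact, then the operation of a topological semigroup `S` extends to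
a jointly continuous semigroup operation on the Stone-Čech compactification. -/
theorem exists_semigroup_stoneCech (S : Type u) [Semigroup S] [TopologicalSpace S]
    [ContinuousMul S] [CountablyCompactSpace (S × S)] :
    ∃ _ : Semigroup (StoneCech S), ContinuousMul (StoneCech S) ∧
      ∀ x y : S, (stoneCechUnit (x * y) : StoneCech S) = stoneCechUnit x * stoneCechUnit y := by
  have : CountablyCompactSpace S := isCountablyCompact_univ_iff.1 (by
    have h := (isCountablyCompact_univ_iff.2 ‹CountablyCompactSpace (S × S)›).image continuous_fst
    rwa [Set.image_univ, Set.range_eq_univ.2 fun x : S => ⟨(x, x), rfl⟩] at h)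
  obtain ⟨m, hm, hmu⟩ := exists_continuous_extend_stoneCech_prod
    (f := fun p : S × S => (stoneCechUnit (p.1 * p.2) : StoneCech S))
    (continuous_stoneCechUnit.comp continuous_mul)
  have hd : DenseRange (stoneCechUnit : S → StoneCech S) := denseRange_stoneCechUnit
  have hassoc : ∀ a b c, m (m (a, b), c) = m (a, m (b, c)) := by
    refine hd.induction_on₃ (isClosed_eq (by fun_prop) (by fun_prop)) fun x y z => ?_
    simp only [hmu, mul_assoc]
  let inst : Semigroup (StoneCech S) := { mul := fun a b => m (a, b), mul_assoc := hassoc }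
  exact ⟨inst, { continuous_mul := hm }, fun x y => (hmu x y).symm⟩

namespace IsCompactification

variable {S : Type u} [Semigroup S] [TopologicalSpace S] {C : SemigroupClass.{u}} {W : Type u}
  [Semigroup W] [TopologicalSpace W] {η : S →ₙ* W}

theorem continuous_betaMap (hη : IsCompactification C η) : Continuous hη.betaMap :=
  haveI := hη.compactSpace
  haveI := hη.t2Space
  continuous_stoneCechExtend hη.continuous

theorem betaMap_stoneCechUnit (hη : IsCompactification C η) (s : S) :
    hη.betaMap (stoneCechUnit s) = η s :=
  haveI := hη.compactSpace
  haveI := hη.t2Space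
  stoneCechExtend_stoneCechUnit hη.continuous s

/-- Multiplication in `W` is only separately continuous, so the density argument treats one variable
at a time. -/
theorem betaMap_mul [Semigroup (StoneCech S)] [ContinuousMul (StoneCech S)]
    (hmul : ∀ x y : S, (stoneCechUnit (x * y) : StoneCech S) = stoneCechUnit x * stoneCechUnit y)
    (hη : IsCompactification C η) (x y : StoneCech S) :
    hη.betaMap (x * y) = hη.betaMap x * hη.betaMap y := by
  have := hη.t2Space
  have := hη.separatelyContinuousMul
  have hb := hη.continuous_betaMap
  have hd : DenseRange (stoneCechUnit : S → StoneCech S) := denseRange_stoneCechUnit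
  refine hd.induction_on x (isClosed_eq (hb.comp (continuous_mul_const y))
    ((continuous_mul_const _).comp hb)) fun s => ?_
  refine hd.induction_on y (isClosed_eq (hb.comp (continuous_const_mul _))
    ((continuous_const_mul _).comp hb)) fun t => ?_
  simp only [← hmul, betaMap_stoneCechUnit, map_mul]

/-- If the operation of `S` extends to an operation on the Stone-Čech compactification that makes
it a topological semigroup of the class `C`, then it is the `C`-compactification. -/
theorem isHomeomorph_betaMap [Semigroup (StoneCech S)] [ContinuousMul (StoneCech S)]
    (hmul : ∀ x y : S, (stoneCechUnit (x * y) : StoneCech S) = stoneCechUnit x * stoneCechUnit y)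
    (hC : C (StoneCech S)) (hη : IsCompactification C η) : IsHomeomorph hη.betaMap := by
  have := hη.compactSpace
  have := hη.t2Space
  have := hη.separatelyContinuousMul
  let ι : S →ₙ* StoneCech S := ⟨stoneCechUnit, hmul⟩
  let b : StoneCech S →ₙ* W := ⟨hη.betaMap, hη.betaMap_mul hmul⟩
  have hb : Continuous b := hη.continuous_betaMap
  have hbι : b.comp ι = η := MulHom.ext hη.betaMap_stoneCechUnit
  obtain ⟨g, ⟨hg, hgη⟩, -⟩ := hη.existsUnique_lift _ hC ι continuous_stoneCechUnit
  refine isHomeomorph_iff_exists_inverse.2 ⟨hb, g, ?_, ?_, hg⟩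
  · refine congrFun (stoneCech_hom_ext (g₁ := g ∘ b) (g₂ := id) (hg.comp hb) continuous_id ?_)
    funext s
    change g (b.comp ι s) = stoneCechUnit s
    rw [hbι]
    exact DFunLike.congr_fun hgη s
  -- Both `b.comp g` and the identity lift `η` through itself, so uniqueness identifies them.
  · have h := (hη.existsUnique_lift W hη.mem η hη.continuous).unique
      (y₁ := b.comp g) (y₂ := MulHom.id W)
      ⟨hb.comp hg, by rw [MulHom.comp_assoc, hgη, hbι]⟩ ⟨continuous_id, MulHom.id_comp η⟩
    exact DFunLike.congr_fun h

theorem map_comp_betaMap {D : SemigroupClass.{u}} {A : Type u} [Semigroup A] [TopologicalSpace A]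
    {θ : S →ₙ* A} (hη : IsCompactification C η) (hθ : IsCompactification D θ) (hDC : D.Le C) :
    hη.map hθ hDC ∘ hη.betaMap = hθ.betaMap := by
  have := hθ.t2Space
  refine stoneCech_hom_ext ((hη.continuous_map hθ hDC).comp hη.continuous_betaMap)
    hθ.continuous_betaMap ?_
  funext s
  simp only [Function.comp_apply, betaMap_stoneCechUnit]
  exact DFunLike.congr_fun (hη.map_comp hθ hDC) s

/-- Bijectivity follows by cancelling `hη.betaMap` in `map_comp_betaMap`; a continuous bijection
from a compact space to a Hausdorff space is a homeomorphism. -/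
theorem isHomeomorph_map {D : SemigroupClass.{u}} {A : Type u} [Semigroup A] [TopologicalSpace A]
    {θ : S →ₙ* A} (hη : IsCompactification C η) (hθ : IsCompactification D θ) (hDC : D.Le C)
    (hbη : IsHomeomorph hη.betaMap) (hbθ : IsHomeomorph hθ.betaMap) :
    IsHomeomorph (hη.map hθ hDC) := by
  have := hη.compactSpace
  have := hθ.t2Space
  refine isHomeomorph_iff_continuous_bijective.2 ⟨hη.continuous_map hθ hDC, ?_⟩
  rw [← Function.Bijective.of_comp_iff _ hbη.bijective, map_comp_betaMap]
  exact hbθ.bijective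

end IsCompactification

theorem mainTheorem9 (S : Type u) [Semigroup S] [TopologicalSpace S] [T35Space S]
    [ContinuousMul S] [CountablyCompactSpace (S × S)]
    (hS : ∃ H : Set S, IsSubgroupOfSemigroup H ∧ Dense H)
    (W : Type u) [Semigroup W] [TopologicalSpace W]
    (A : Type u) [Semigroup A] [TopologicalSpace A]
    (G : Type u) [Semigroup G] [TopologicalSpace G]
    (ηW : S →ₙ* W) (hW : IsCompactification WAPClass ηW)
    (ηA : S →ₙ* A) (hA : IsCompactification APClass ηA)
    (ηG : S →ₙ* G) (hG : IsCompactification SAPClass ηG) :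
    IsHomeomorph hW.betaMap ∧
      IsHomeomorph (hW.map hA APClass_le_WAPClass) ∧
      IsHomeomorph (hA.map hG SAPClass_le_APClass) := by
  obtain ⟨H, hH, hHd⟩ := hS
  obtain ⟨_, hcont, hmul⟩ := exists_semigroup_stoneCech S
  have hβ : SAPClass (StoneCech S) := SAPClass_of_dense_subgroup
    (hH.image (⟨stoneCechUnit, hmul⟩ : S →ₙ* StoneCech S))
    (denseRange_stoneCechUnit.dense_image continuous_stoneCechUnit hHd)
  have hbW := hW.isHomeomorph_betaMap hmul trivial
  have hbA := hA.isHomeomorph_betaMap hmul hcont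
  have hbG := hG.isHomeomorph_betaMap hmul hβ
  exact ⟨hbW, hW.isHomeomorph_map hA _ hbW hbA, hA.isHomeomorph_map hG _ hbA hbG⟩
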